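/- Let $\mathcal C$ be a category with pullbacks and let $p:\mathcal E\to\mathcal C$ be a cloven bifibration, i.e. a functor with, for every $f:B\to A$ in $\mathcal C$, a chosen cartesian lift $\hat f_X:f^*X\to X$ of $f$ at every object $X$ of the fiber $\mathcal E_A$ and a chosen cocartesian lift $\tilde f_Y:Y\to f_!Y$ of $f$ at every object $Y$ of the fiber $\mathcal E_B$. These choices induce functors $f^*:\mathcal E_A\to\mathcal E_B$ and $f_!:\mathcal E_B\to\mathcal E_A$, canonical isomorphisms $\iota_B:\mathrm{Id}\Rightarrow(\mathrm{id}_B)^*$ and $\kappa_{f,g}:g^*f^*\Rightarrow(f\circ g)^*$, and an adjunction in which $f_!$ is left adjoint to $f^*$, with unit $\eta_f$ and counit $\varepsilon_f$. Suppose that $p$ satisfies the Beck–Chevalley condition: for every pullback square $d\circ a=e\circ c$ in $\mathcal C$ the transformation $$\mathsf{BC}=(\varepsilon_c\cdot e^*d_!)\circ(c_!\cdot(\kappa_{e,c}^{-1}\circ\kappa_{d,a})\cdot d_!)\circ(c_!a^*\cdot\eta_d):\ c_!a^*\Rightarrow e^*d_!$$ is an isomorphism. Let $f:B\to A$ be a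 morphism of $\mathcal C$, let $f_1,f_2:B\times_AB\to B$ be its kernel pair, let $\pi_1,\pi_2:(B\times_AB)\times_B(B\times_AB)\to B\times_AB$ be the pullback projections with $f_2\pi_2=f_1\pi_1$, and put $\Delta=\langle\mathrm{id}_B,\mathrm{id}_B\rangle:B\to B\times_AB$ and $\pi=\langle f_1\pi_2,f_2\pi_1\rangle$. Consider the canonical isomorphisms $d_i=\kappa_{f_i,\Delta}^{-1}\circ\iota_B:\mathrm{Id}\Rightarrow\Delta^*f_i^*$ and $j_i=\kappa_{f_i,\pi_{3-i}}^{-1}\circ\kappa_{f_i,\pi}:\pi^*f_i^*\Rightarrow\pi_{3-i}^*f_i^*$ ($i=1,2$), and $j=\kappa_{f_1,\pi_1}^{-1}\circ\kappa_{f_2,\pi_2}:\pi_2^*f_2^*\Rightarrow\pi_1^*f_1^*$. Define three categories. * $\mathsf{EM}_p(T_f)$ is the Eilenberg–Moore category of the monad $T_f=(f^*f_!,\eta_f,f^*\varepsilon_ff_!)$ on $\mathcal E_B$. * $\mathsf{Desc}_p(f)$ has as objects the pairs $(X,\varphi)$ of an object $X$ of $\mathcal E_B$ and an isomorphism $\varphi:f_1^*X\to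 f_2^*X$ in $\mathcal E_{B\times_AB}$ such that (DD1) $(d_2^{-1})_X\circ\Delta^*\varphi\circ(d_1)_X=\mathrm{id}_X$ and (DD2) $\pi_1^*\varphi\circ j_X\circ\pi_2^*\varphi=(j_2)_X\circ\pi^*\varphi\circ(j_1^{-1})_X$; a morphism $(X,\varphi)\to(Y,\psi)$ is an arrow $\theta:X\to Y$ of $\mathcal E_B$ with $f_2^*\theta\circ\varphi=\psi\circ f_1^*\theta$. * $\mathsf{Act}_p^{\mathsf{Eq}(f)}$ has as objects the pairs $(X,\beta)$ of an object $X$ of $\mathcal E_B$ and an arrow $\beta:(f_2)_!f_1^*X\to X$ of $\mathcal E_B$ such that (AC1) $\beta\circ\eta'_X=\mathrm{id}_X$ and (AC2) $\beta\circ\mu'_X=\beta\circ(f_2)_!f_1^*\beta$, where $\eta'=(d_2^{-1}\cdot(f_2)_!f_1^*)\circ(\Delta^*\cdot\eta_{f_2}\cdot f_1^*)\circ d_1$ and $\mu'=((f_2)_!\cdot\varepsilon_\pi\cdot f_1^*)\circ(k_2\cdot j_1^{-1})\circ((f_2)_!\cdot\mathsf{BC}^{-1}\cdot f_1^*)$;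 here $\mathsf{BC}:(\pi_1)_!\pi_2^*\Rightarrow f_1^*(f_2)_!$ is the Beck–Chevalley isomorphism of the pullback square $f_2\pi_2=f_1\pi_1$, and $k_2:(f_2)_!(\pi_1)_!\Rightarrow(f_2)_!\pi_!$ is the transformation of left adjoints corresponding (as its mate) to $j_2$; a morphism $(X,\beta)\to(X',\beta')$ is an arrow $h:X\to X'$ of $\mathcal E_B$ with $h\circ\beta=\beta'\circ(f_2)_!f_1^*h$. Then the three categories are equivalent, $$\mathsf{EM}_p(T_f)\simeq\mathsf{Desc}_p(f)\simeq\mathsf{Act}_p^{\mathsf{Eq}(f)}.$$ More precisely, there are equivalences $F:\mathsf{EM}_p(T_f)\to\mathsf{Desc}_p(f)$, $G:\mathsf{Desc}_p(f)\to\mathsf{Act}_p^{\mathsf{Eq}(f)}$ and $H:\mathsf{Act}_p^{\mathsf{Eq}(f)}\to\mathsf{EM}_p(T_f)$, commuting with the forgetful functors to $\mathcal E_B$, such that each of the composites $HGF$, $FHG$ and $GFH$ is the identity functor. -/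

import Mathlib

open CategoryTheory CategoryTheory.Limits

open CategoryTheory.Functor.Fiber (fiberInclusion)

-- Arrows `X ⟶ Y` of a category are then read through `CategoryStruct.toQuiver` only.
attribute [-instance] catToReflQuiver

universe v₁ u₁ v₂ u₂

/-- A cloven bifibration structure on a functor `p : E ⥤ C`: for every `f : B ⟶ A` in `C` a chosen
cartesian lift `f^* X ⟶ X` of `f` at every `X` in the fiber over `A` (a cleavage), and a chosen
cocartesian lift `Y ⟶ f_! Y` of `f` at every `Y` in the fiber over `B` (a cocleavage).
`IsStronglyCartesian` / `IsStronglyCocartesian` is Mathlib's name for the usual (co)cartesian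
arrows, whose universal property is about arrows over arbitrary composites in the base. -/
structure ClovenBifibration {C : Type u₁} [Category.{v₁} C] {E : Type u₂} [Category.{v₂} E]
    (p : E ⥤ C) where
  /-- The domain `f^* X` of the chosen cartesian lift of `f` at `X`. -/
  pullObj {A B : C} (f : B ⟶ A) (X : p.Fiber A) : p.Fiber B
  /-- The chosen cartesian lift `f^* X ⟶ X`. -/
  cart {A B : C} (f : B ⟶ A) (X : p.Fiber A) :
    fiberInclusion.obj (pullObj f X) ⟶ fiberInclusion.obj X
  cart_isStronglyCartesian {A B : C} (f : B ⟶ A) (X : p.Fiber A) :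
    p.IsStronglyCartesian f (cart f X)
  /-- The codomain `f_! Y` of the chosen cocartesian lift of `f` at `Y`. -/
  pushObj {A B : C} (f : B ⟶ A) (Y : p.Fiber B) : p.Fiber A
  /-- The chosen cocartesian lift `Y ⟶ f_! Y`. -/
  cocart {A B : C} (f : B ⟶ A) (Y : p.Fiber B) :
    fiberInclusion.obj Y ⟶ fiberInclusion.obj (pushObj f Y)
  cocart_isStronglyCocartesian {A B : C} (f : B ⟶ A) (Y : p.Fiber B) :
    p.IsStronglyCocartesian f (cocart f Y)

namespace ClovenBifibration

attribute [instance] cart_isStronglyCartesian cocart_isStronglyCocartesian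

noncomputable section

variable {C : Type u₁} [Category.{v₁} C] {E : Type u₂} [Category.{v₂} E] {p : E ⥤ C}

/-- An arrow of `E` over the identity of `A`, as an arrow of the fiber over `A`. -/
def homOf {A : C} {X Y : p.Fiber A} (t : fiberInclusion.obj X ⟶ fiberInclusion.obj Y)
    [h : p.IsHomLift (𝟙 A) t] : X ⟶ Y := ⟨t, h⟩

theorem map_homOf {A : C} {X Y : p.Fiber A} (t : fiberInclusion.obj X ⟶ fiberInclusion.obj Y)
    [p.IsHomLift (𝟙 A) t] : fiberInclusion.map (homOf t) = t := rfl

variable (b : ClovenBifibration p)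

section Basic

variable {A B : C} (f : B ⟶ A)

/-- The unique arrow `Z ⟶ f^* X` of the fiber over `B` through which an arrow `h : Z ⟶ X` over `f`
factors. -/
def pullLift {Z : p.Fiber B} {X : p.Fiber A} (h : fiberInclusion.obj Z ⟶ fiberInclusion.obj X)
    [p.IsHomLift f h] : Z ⟶ b.pullObj f X :=
  homOf (Functor.IsCartesian.map p f (b.cart f X) h)

theorem pullLift_fac {Z : p.Fiber B} {X : p.Fiber A}
    (h : fiberInclusion.obj Z ⟶ fiberInclusion.obj X) [p.IsHomLift f h] :
    fiberInclusion.map (b.pullLift f h) ≫ b.cart f X = h :=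
  Functor.IsCartesian.fac p f (b.cart f X) h

theorem pull_hom_ext {Z : p.Fiber B} {X : p.Fiber A} {s t : Z ⟶ b.pullObj f X}
    (h : fiberInclusion.map s ≫ b.cart f X = fiberInclusion.map t ≫ b.cart f X) : s = t :=
  Functor.Fiber.hom_ext (Functor.IsCartesian.ext p f (b.cart f X) _ _ h)

/-- The unique arrow `f_! Y ⟶ Z` of the fiber over `A` through which an arrow `h : Y ⟶ Z` over `f`
factors. -/
def pushDesc {Y : p.Fiber B} {Z : p.Fiber A} (h : fiberInclusion.obj Y ⟶ fiberInclusion.obj Z)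
    [p.IsHomLift f h] : b.pushObj f Y ⟶ Z :=
  homOf (Functor.IsCocartesian.map p f (b.cocart f Y) h)

theorem pushDesc_fac {Y : p.Fiber B} {Z : p.Fiber A}
    (h : fiberInclusion.obj Y ⟶ fiberInclusion.obj Z) [p.IsHomLift f h] :
    b.cocart f Y ≫ fiberInclusion.map (b.pushDesc f h) = h :=
  Functor.IsCocartesian.fac p f (b.cocart f Y) h

theorem push_hom_ext {Y : p.Fiber B} {Z : p.Fiber A} {s t : b.pushObj f Y ⟶ Z}
    (h : b.cocart f Y ≫ fiberInclusion.map s = b.cocart f Y ≫ fiberInclusion.map t) : s = t :=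
  Functor.Fiber.hom_ext (Functor.IsCocartesian.ext p f (b.cocart f Y) _ _ h)

/-- The action of `f^*` on arrows. -/
def pullMap {X Y : p.Fiber A} (t : X ⟶ Y) : b.pullObj f X ⟶ b.pullObj f Y :=
  b.pullLift f (b.cart f X ≫ fiberInclusion.map t)

theorem pullMap_fac {X Y : p.Fiber A} (t : X ⟶ Y) :
    fiberInclusion.map (b.pullMap f t) ≫ b.cart f Y = b.cart f X ≫ fiberInclusion.map t :=
  b.pullLift_fac f _

/-- The pullback functor `f^* : E_A ⥤ E_B`. -/
def pull : p.Fiber A ⥤ p.Fiber B where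
  obj X := b.pullObj f X
  map t := b.pullMap f t
  map_id X := b.pull_hom_ext f (by
    rw [pullMap_fac, CategoryTheory.Functor.map_id, CategoryTheory.Functor.map_id, Category.comp_id,
      Category.id_comp])
  map_comp s t := b.pull_hom_ext f (by
    rw [pullMap_fac, Functor.map_comp, Functor.map_comp, Category.assoc, pullMap_fac,
      reassoc_of% b.pullMap_fac f s])

/-- The action of `f_!` on arrows. -/
def pushMap {X Y : p.Fiber B} (t : X ⟶ Y) : b.pushObj f X ⟶ b.pushObj f Y :=
  b.pushDesc f (fiberInclusion.map t ≫ b.cocart f Y)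

theorem pushMap_fac {X Y : p.Fiber B} (t : X ⟶ Y) :
    b.cocart f X ≫ fiberInclusion.map (b.pushMap f t) = fiberInclusion.map t ≫ b.cocart f Y :=
  b.pushDesc_fac f _

/-- The direct image functor `f_! : E_B ⥤ E_A`. -/
def push : p.Fiber B ⥤ p.Fiber A where
  obj Y := b.pushObj f Y
  map t := b.pushMap f t
  map_id X := b.push_hom_ext f (by
    rw [pushMap_fac, CategoryTheory.Functor.map_id, CategoryTheory.Functor.map_id, Category.comp_id,
      Category.id_comp])
  map_comp s t := b.push_hom_ext f (by
    rw [pushMap_fac, Functor.map_comp, Functor.map_comp, reassoc_of% b.pushMap_fac f s,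
      pushMap_fac, Category.assoc])

/-- The component of the unit `η_f` at `X`: the factorization of the cocartesian lift `X ⟶ f_! X`
through the cartesian lift `f^* f_! X ⟶ f_! X`. -/
def unitApp (X : p.Fiber B) : X ⟶ b.pullObj f (b.pushObj f X) := b.pullLift f (b.cocart f X)

theorem unitApp_fac (X : p.Fiber B) :
    fiberInclusion.map (b.unitApp f X) ≫ b.cart f (b.pushObj f X) = b.cocart f X :=
  b.pullLift_fac f _

theorem unitApp_naturality {X Y : p.Fiber B} (t : X ⟶ Y) :
    t ≫ b.unitApp f Y = b.unitApp f X ≫ b.pullMap f (b.pushMap f t) :=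
  b.pull_hom_ext f (by
    rw [Functor.map_comp, Functor.map_comp, Category.assoc, Category.assoc, unitApp_fac,
      pullMap_fac, reassoc_of% b.unitApp_fac f X, pushMap_fac])

/-- The component of the counit `ε_f` at `Y`: the factorization of the cartesian lift `f^* Y ⟶ Y`
through the cocartesian lift `f^* Y ⟶ f_! f^* Y`. -/
def counitApp (Y : p.Fiber A) : b.pushObj f (b.pullObj f Y) ⟶ Y := b.pushDesc f (b.cart f Y)

theorem counitApp_fac (Y : p.Fiber A) :
    b.cocart f (b.pullObj f Y) ≫ fiberInclusion.map (b.counitApp f Y) = b.cart f Y :=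
  b.pushDesc_fac f _

theorem counitApp_naturality {X Y : p.Fiber A} (t : X ⟶ Y) :
    b.pushMap f (b.pullMap f t) ≫ b.counitApp f Y = b.counitApp f X ≫ t :=
  b.push_hom_ext f (by
    rw [Functor.map_comp, Functor.map_comp, reassoc_of% b.pushMap_fac f (b.pullMap f t),
      counitApp_fac, pullMap_fac, reassoc_of% b.counitApp_fac f X])

theorem left_triangle (Y : p.Fiber B) :
    b.pushMap f (b.unitApp f Y) ≫ b.counitApp f (b.pushObj f Y) = 𝟙 (b.pushObj f Y) :=
  b.push_hom_ext f (by
    rw [Functor.map_comp, reassoc_of% b.pushMap_fac f (b.unitApp f Y), counitApp_fac, unitApp_fac,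
      CategoryTheory.Functor.map_id, Category.comp_id])

theorem right_triangle (X : p.Fiber A) :
    b.unitApp f (b.pullObj f X) ≫ b.pullMap f (b.counitApp f X) = 𝟙 (b.pullObj f X) :=
  b.pull_hom_ext f (by
    rw [Functor.map_comp, Category.assoc, pullMap_fac, reassoc_of% b.unitApp_fac f (b.pullObj f X),
      counitApp_fac, CategoryTheory.Functor.map_id, Category.id_comp])

/-- The adjunction `f_! ⊣ f^*` with unit `η_f` and counit `ε_f`. -/
def adj : b.push f ⊣ b.pull f where
  unit :=
    { app := fun X => b.unitApp f X
      naturality := fun _ _ t => b.unitApp_naturality f t }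
  counit :=
    { app := fun Y => b.counitApp f Y
      naturality := fun _ _ t => b.counitApp_naturality f t }
  left_triangle_components Y := b.left_triangle f Y
  right_triangle_components X := b.right_triangle f X

end Basic

theorem id_isHomLift {B : C} (X : p.Fiber B) : p.IsHomLift (𝟙 B) (𝟙 (fiberInclusion.obj X)) :=
  IsHomLift.id X.2

/-- The component at `X` of the canonical isomorphism `ι_B : Id ≅ (id_B)^*`: the factorization of
`id_X` through the cartesian lift `(id_B)^* X ⟶ X`. -/
def iotaApp {B : C} (X : p.Fiber B) : X ≅ b.pullObj (𝟙 B) X where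
  hom := haveI := id_isHomLift X; b.pullLift (𝟙 B) (𝟙 (fiberInclusion.obj X))
  inv := homOf (b.cart (𝟙 B) X)
  hom_inv_id := Functor.Fiber.hom_ext (by
    rw [Functor.map_comp, map_homOf, pullLift_fac, CategoryTheory.Functor.map_id])
  inv_hom_id := b.pull_hom_ext (𝟙 B) (by
    rw [Functor.map_comp, Category.assoc, map_homOf, pullLift_fac, CategoryTheory.Functor.map_id,
      Category.comp_id, Category.id_comp])

theorem iotaApp_fac {B : C} (X : p.Fiber B) :
    fiberInclusion.map (b.iotaApp X).hom ≫ b.cart (𝟙 B) X = 𝟙 (fiberInclusion.obj X) :=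
  haveI := id_isHomLift X
  b.pullLift_fac (𝟙 B) _

theorem iotaApp_naturality {B : C} {X Y : p.Fiber B} (t : X ⟶ Y) :
    t ≫ (b.iotaApp Y).hom = (b.iotaApp X).hom ≫ b.pullMap (𝟙 B) t :=
  b.pull_hom_ext (𝟙 B) (by
    rw [Functor.map_comp, Functor.map_comp, Category.assoc, Category.assoc, iotaApp_fac,
      pullMap_fac, reassoc_of% b.iotaApp_fac X, Category.comp_id])

/-- The canonical isomorphism `ι_B : Id ≅ (id_B)^*`. -/
def iota (B : C) : 𝟭 (p.Fiber B) ≅ b.pull (𝟙 B) :=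
  NatIso.ofComponents (fun X => b.iotaApp X) (fun t => b.iotaApp_naturality t)

section Kappa

variable {A B D : C} (f : B ⟶ A) (g : D ⟶ B) (h : D ⟶ A)

/-- The composite `g^* f^* Y ⟶ f^* Y ⟶ Y` of chosen cartesian lifts. -/
def cartComp (Y : p.Fiber A) :
    fiberInclusion.obj (b.pullObj g (b.pullObj f Y)) ⟶ fiberInclusion.obj Y :=
  b.cart g (b.pullObj f Y) ≫ b.cart f Y

theorem cartComp_isStronglyCartesian (w : g ≫ f = h) (Y : p.Fiber A) :
    p.IsStronglyCartesian h (b.cartComp f g Y) := by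
  subst w
  exact Functor.IsStronglyCartesian.comp p

/-- The component at `Y` of the canonical isomorphism `κ_{f,g} : g^* f^* ≅ (f ∘ g)^*`: the
factorization of `g^* f^* Y ⟶ f^* Y ⟶ Y` through the cartesian lift `(f ∘ g)^* Y ⟶ Y`. -/
def kappaApp (w : g ≫ f = h) (Y : p.Fiber A) :
    b.pullObj g (b.pullObj f Y) ≅ b.pullObj h Y :=
  haveI := b.cartComp_isStronglyCartesian f g h w Y
  { hom := b.pullLift h (b.cartComp f g Y)
    inv := homOf (Functor.IsCartesian.map p h (b.cartComp f g Y) (b.cart h Y))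
    hom_inv_id := Functor.Fiber.hom_ext (Functor.IsCartesian.ext p h (b.cartComp f g Y) _ _ (by
      rw [Functor.map_comp, Category.assoc, map_homOf, Functor.IsCartesian.fac, pullLift_fac,
        CategoryTheory.Functor.map_id, Category.id_comp]))
    inv_hom_id := b.pull_hom_ext h (by
      rw [Functor.map_comp, Category.assoc, map_homOf, pullLift_fac, Functor.IsCartesian.fac,
        CategoryTheory.Functor.map_id, Category.id_comp]) }

theorem kappaApp_fac (w : g ≫ f = h) (Y : p.Fiber A) :
    fiberInclusion.map (b.kappaApp f g h w Y).hom ≫ b.cart h Y =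
      b.cart g (b.pullObj f Y) ≫ b.cart f Y :=
  haveI := b.cartComp_isStronglyCartesian f g h w Y
  b.pullLift_fac h (b.cartComp f g Y)

theorem kappaApp_naturality (w : g ≫ f = h) {X Y : p.Fiber A} (t : X ⟶ Y) :
    b.pullMap g (b.pullMap f t) ≫ (b.kappaApp f g h w Y).hom =
      (b.kappaApp f g h w X).hom ≫ b.pullMap h t :=
  b.pull_hom_ext h (by
    rw [Functor.map_comp, Functor.map_comp, Category.assoc, Category.assoc, kappaApp_fac,
      pullMap_fac, reassoc_of% b.kappaApp_fac f g h w X,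
      reassoc_of% b.pullMap_fac g (b.pullMap f t), pullMap_fac])

/-- The canonical isomorphism `κ_{f,g} : g^* f^* ≅ (f ∘ g)^*`. The composite `f ∘ g` is allowed to
be given as any `h` with a proof of `g ≫ f = h`. -/
def kappa (w : g ≫ f = h) : b.pull f ⋙ b.pull g ≅ b.pull h :=
  NatIso.ofComponents (fun Y => b.kappaApp f g h w Y) (fun t => b.kappaApp_naturality f g h w t)

end Kappa

/-- The canonical isomorphism `χ = κ_{h,k}⁻¹ ∘ κ_{f,g} : g^* f^* ≅ k^* h^*` of a commutative square
`f ∘ g = h ∘ k`. -/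
def chi {A B B' D : C} {f : B ⟶ A} {g : D ⟶ B} {h : B' ⟶ A} {k : D ⟶ B'} (w : g ≫ f = k ≫ h) :
    b.pull f ⋙ b.pull g ≅ b.pull h ⋙ b.pull k :=
  b.kappa f g (k ≫ h) w ≪≫ (b.kappa h k (k ≫ h) rfl).symm

/-- The Beck-Chevalley transformation `c_! a^* ⟶ e^* d_!` of a commutative square
`d ∘ a = e ∘ c`: the composite of `c_! a^* η_d`, `c_! χ d_!` and `ε_c e^* d_!`. -/
def beckChevalley {P B Q D : C} {a : P ⟶ B} {c : P ⟶ Q} {d : B ⟶ D} {e : Q ⟶ D}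
    (w : a ≫ d = c ≫ e) : b.pull a ⋙ b.push c ⟶ b.push d ⋙ b.pull e where
  app X := (b.push c).map ((b.pull a).map ((b.adj d).unit.app X)) ≫
    (b.push c).map ((b.chi w).hom.app ((b.push d).obj X)) ≫
    (b.adj c).counit.app ((b.pull e).obj ((b.push d).obj X))
  naturality X Y t := by
    have h₁ := congrArg (fun s => (b.push c).map ((b.pull a).map s)) ((b.adj d).unit.naturality t)
    have h₂ := congrArg (b.push c).map ((b.chi w).hom.naturality ((b.push d).map t))
    have h₃ := (b.adj c).counit.naturality ((b.pull e).map ((b.push d).map t))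
    simp only [Functor.map_comp, Functor.comp_map, Functor.id_map] at h₁ h₂ h₃ ⊢
    simp only [Category.assoc]
    erw [reassoc_of% h₁, reassoc_of% h₂, h₃]

/-- The Beck-Chevalley property: the Beck-Chevalley transformation of every pullback square of `C`
is an isomorphism. -/
def BeckChevalley : Prop :=
  ∀ ⦃P B Q D : C⦄ ⦃a : P ⟶ B⦄ ⦃c : P ⟶ Q⦄ ⦃d : B ⟶ D⦄ ⦃e : Q ⟶ D⦄ (h : IsPullback a c d e),
    IsIso (b.beckChevalley h.w)

/-- The monad `T_f = f^* f_!` on `E_B`, with unit `η_f` and multiplication `f^* ε_f f_!`. -/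
def T {A B : C} (f : B ⟶ A) : Monad (p.Fiber B) := (b.adj f).toMonad

/-- The Eilenberg-Moore category of `T_f`. -/
abbrev EM {A B : C} (f : B ⟶ A) := (b.T f).Algebra

section Descent

variable [HasPullbacks C] {A B : C} (f : B ⟶ A)

/-- `B ×_A B`. -/
abbrev ker : C := pullback f f

/-- The first projection of the kernel pair of `f`. -/
abbrev f₁ : ker f ⟶ B := pullback.fst f f

/-- The second projection of the kernel pair of `f`. -/
abbrev f₂ : ker f ⟶ B := pullback.snd f f

/-- `(B ×_A B) ×_B (B ×_A B)`, the pullback of `f₂` and `f₁`, so that `f₂ ∘ π₂ = f₁ ∘ π₁`. -/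
abbrev ker₂ : C := pullback (f₂ f) (f₁ f)

/-- The projection `π₁`, with `f₁ ∘ π₁ = f₂ ∘ π₂`. -/
abbrev π₁ : ker₂ f ⟶ ker f := pullback.snd (f₂ f) (f₁ f)

/-- The projection `π₂`, with `f₂ ∘ π₂ = f₁ ∘ π₁`. -/
abbrev π₂ : ker₂ f ⟶ ker f := pullback.fst (f₂ f) (f₁ f)

/-- The identity-assigning morphism `Δ = ⟨id, id⟩` of the internal category `Eq(f)`. -/
def diag : B ⟶ ker f := pullback.lift (𝟙 B) (𝟙 B) rfl

/-- The composition morphism `π = ⟨f₁ π₂, f₂ π₁⟩` of the internal category `Eq(f)`. -/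
def π : ker₂ f ⟶ ker f :=
  pullback.lift (π₂ f ≫ f₁ f) (π₁ f ≫ f₂ f) (by
    rw [Category.assoc, Category.assoc, pullback.condition (f := f) (g := f),
      pullback.condition_assoc (f := f₂ f) (g := f₁ f), pullback.condition (f := f) (g := f)])

theorem diag_f₁ : diag f ≫ f₁ f = 𝟙 B := pullback.lift_fst _ _ _

theorem diag_f₂ : diag f ≫ f₂ f = 𝟙 B := pullback.lift_snd _ _ _

theorem π_f₁ : π f ≫ f₁ f = π₂ f ≫ f₁ f := pullback.lift_fst _ _ _

theorem π_f₂ : π f ≫ f₂ f = π₁ f ≫ f₂ f := pullback.lift_snd _ _ _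

theorem π₂_f₂ : π₂ f ≫ f₂ f = π₁ f ≫ f₁ f := pullback.condition

/-- `d₁ : Id ≅ Δ^* f₁^*`. -/
def d₁ : 𝟭 (p.Fiber B) ≅ b.pull (f₁ f) ⋙ b.pull (diag f) :=
  b.iota B ≪≫ (b.kappa (f₁ f) (diag f) (𝟙 B) (diag_f₁ f)).symm

/-- `d₂ : Id ≅ Δ^* f₂^*`. -/
def d₂ : 𝟭 (p.Fiber B) ≅ b.pull (f₂ f) ⋙ b.pull (diag f) :=
  b.iota B ≪≫ (b.kappa (f₂ f) (diag f) (𝟙 B) (diag_f₂ f)).symm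

/-- `j₁ : π^* f₁^* ≅ π₂^* f₁^*`. -/
def j₁ : b.pull (f₁ f) ⋙ b.pull (π f) ≅ b.pull (f₁ f) ⋙ b.pull (π₂ f) := b.chi (π_f₁ f)

/-- `j₂ : π^* f₂^* ≅ π₁^* f₂^*`. -/
def j₂ : b.pull (f₂ f) ⋙ b.pull (π f) ≅ b.pull (f₂ f) ⋙ b.pull (π₁ f) := b.chi (π_f₂ f)

/-- `j : π₂^* f₂^* ≅ π₁^* f₁^*`. -/
def j : b.pull (f₂ f) ⋙ b.pull (π₂ f) ≅ b.pull (f₁ f) ⋙ b.pull (π₁ f) := b.chi (π₂_f₂ f)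

/-- An object of `Desc_p(f)`: an object `X` of `E_B` with a descent datum
`φ : f₁^* X ⟶ f₂^* X`. -/
structure Desc where
  /-- The underlying object. -/
  X : p.Fiber B
  /-- The descent datum. -/
  φ : (b.pull (f₁ f)).obj X ⟶ (b.pull (f₂ f)).obj X
  isIso : IsIso φ
  dd1 : (b.d₁ f).hom.app X ≫ (b.pull (diag f)).map φ ≫ (b.d₂ f).inv.app X = 𝟙 X
  dd2 : (b.pull (π₂ f)).map φ ≫ (b.j f).hom.app X ≫ (b.pull (π₁ f)).map φ =
    (b.j₁ f).inv.app X ≫ (b.pull (π f)).map φ ≫ (b.j₂ f).hom.app X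

/-- A morphism of descent data. -/
@[ext]
structure Desc.Hom {b : ClovenBifibration p} {f : B ⟶ A} (M N : b.Desc f) where
  /-- The underlying arrow of `E_B`. -/
  θ : M.X ⟶ N.X
  comm : M.φ ≫ (b.pull (f₂ f)).map θ = (b.pull (f₁ f)).map θ ≫ N.φ

/-- The category `Desc_p(f)`. -/
instance : Category (b.Desc f) where
  Hom M N := Desc.Hom M N
  id M := ⟨𝟙 M.X, by simp⟩
  comp s t := ⟨s.θ ≫ t.θ, by
    rw [Functor.map_comp, Functor.map_comp, ← Category.assoc, s.comm, Category.assoc, t.comm,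
      Category.assoc]⟩
  id_comp s := Desc.Hom.ext (Category.id_comp s.θ)
  comp_id s := Desc.Hom.ext (Category.comp_id s.θ)
  assoc s t r := Desc.Hom.ext (Category.assoc s.θ t.θ r.θ)

/-- The forgetful functor `Desc_p(f) ⥤ E_B`. -/
def Desc.forget : b.Desc f ⥤ p.Fiber B where
  obj M := M.X
  map s := s.θ
  map_id _ := rfl
  map_comp _ _ := rfl

/-- `k₂ : (f₂)_! (π₁)_! ⟶ (f₂)_! π_!`, the two-fold mate of `j₂`, i.e. the transformation between
the composite left adjoints corresponding to `j₂ : π^* f₂^* ⟶ π₁^* f₂^*`. -/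
def k₂ : b.push (π₁ f) ⋙ b.push (f₂ f) ⟶ b.push (π f) ⋙ b.push (f₂ f) :=
  (conjugateEquiv ((b.adj (π f)).comp (b.adj (f₂ f)))
    ((b.adj (π₁ f)).comp (b.adj (f₂ f)))).symm (b.j₂ f).hom

/-- The inverse of the Beck-Chevalley transformation of the pullback square `f₂ ∘ π₂ = f₁ ∘ π₁`. -/
def bcInv {b : ClovenBifibration p} (h : b.BeckChevalley) (f : B ⟶ A) :
    b.push (f₂ f) ⋙ b.pull (f₁ f) ⟶ b.pull (π₂ f) ⋙ b.push (π₁ f) :=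
  haveI := h (IsPullback.of_hasPullback (f₂ f) (f₁ f))
  inv (b.beckChevalley (IsPullback.of_hasPullback (f₂ f) (f₁ f)).w)

/-- The component at `X` of `η' : Id ⟶ (f₂)_! f₁^*`, the composite
`d₂⁻¹ (f₂)_! f₁^* ∘ Δ^* η_{f₂} f₁^* ∘ d₁`. -/
def eta' (X : p.Fiber B) : X ⟶ (b.push (f₂ f)).obj ((b.pull (f₁ f)).obj X) :=
  (b.d₁ f).hom.app X ≫
    (b.pull (diag f)).map ((b.adj (f₂ f)).unit.app ((b.pull (f₁ f)).obj X)) ≫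
    (b.d₂ f).inv.app ((b.push (f₂ f)).obj ((b.pull (f₁ f)).obj X))

/-- The component at `X` of `μ' : (f₂)_! f₁^* (f₂)_! f₁^* ⟶ (f₂)_! f₁^*`, the composite
`(f₂)_! ε_π f₁^* ∘ (k₂ · j₁⁻¹) ∘ (f₂)_! BC⁻¹ f₁^*`. -/
def mu' {b : ClovenBifibration p} (h : b.BeckChevalley) (f : B ⟶ A) (X : p.Fiber B) :
    (b.push (f₂ f)).obj ((b.pull (f₁ f)).obj ((b.push (f₂ f)).obj ((b.pull (f₁ f)).obj X))) ⟶
      (b.push (f₂ f)).obj ((b.pull (f₁ f)).obj X) :=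
  (b.push (f₂ f)).map ((bcInv h f).app ((b.pull (f₁ f)).obj X)) ≫
    (b.push (f₂ f)).map ((b.push (π₁ f)).map ((b.j₁ f).inv.app X)) ≫
    (b.k₂ f).app ((b.pull (π f)).obj ((b.pull (f₁ f)).obj X)) ≫
    (b.push (f₂ f)).map ((b.adj (π f)).counit.app ((b.pull (f₁ f)).obj X))

/-- An action `(X, β)` of the internal category `Eq(f)` on `p`. -/
structure Act {b : ClovenBifibration p} (h : b.BeckChevalley) (f : B ⟶ A) where
  /-- The underlying object. -/
  X : p.Fiber B
  /-- The action. -/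
  β : (b.push (f₂ f)).obj ((b.pull (f₁ f)).obj X) ⟶ X
  ac1 : b.eta' f X ≫ β = 𝟙 X
  ac2 : mu' h f X ≫ β = (b.push (f₂ f)).map ((b.pull (f₁ f)).map β) ≫ β

/-- A morphism of actions. -/
@[ext]
structure Act.Hom {b : ClovenBifibration p} {h : b.BeckChevalley} {f : B ⟶ A}
    (M N : Act h f) where
  /-- The underlying arrow of `E_B`. -/
  θ : M.X ⟶ N.X
  comm : M.β ≫ θ = (b.push (f₂ f)).map ((b.pull (f₁ f)).map θ) ≫ N.β

variable {b} (h : b.BeckChevalley)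

/-- The category of actions of `Eq(f)` on `p`. -/
instance : Category (Act h f) where
  Hom M N := Act.Hom M N
  id M := ⟨𝟙 M.X, by simp⟩
  comp s t := ⟨s.θ ≫ t.θ, by
    rw [Functor.map_comp, Functor.map_comp, ← Category.assoc, s.comm, Category.assoc, t.comm,
      Category.assoc]⟩
  id_comp s := Act.Hom.ext (Category.id_comp s.θ)
  comp_id s := Act.Hom.ext (Category.comp_id s.θ)
  assoc s t r := Act.Hom.ext (Category.assoc s.θ t.θ r.θ)

/-- The forgetful functor from actions of `Eq(f)` to `E_B`. -/
def Act.forget : Act h f ⥤ p.Fiber B where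
  obj M := M.X
  map s := s.θ
  map_id _ := rfl
  map_comp _ _ := rfl

end Descent

end

end ClovenBifibration

/-!
Over an object `X` of the fiber over `B`, descent data, actions of `Eq(f)` and `T_f`-algebra
structures all correspond to arrows `u : f₁^* X ⟶ X` of `E` over `f₂`: descent data by composing
with the cartesian lift `f₂^* X ⟶ X`, actions by composing with the cocartesian lift
`f₁^* X ⟶ (f₂)_! f₁^* X`, and algebra structures by composing with the canonical arrow
`f₁^* X ⟶ f^* f_! X` over `f₂`. The last arrow is the base change of `X ⟶ f_! X` along the kernel
pair square, and the Beck-Chevalley condition says precisely that base change along pullback squares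
preserves cocartesian arrows.

Under these bijections the axioms of all three structures become the same unit and associativity
laws for `u`. Invertibility of a descent datum is automatic: `u` lifts the symmetry of the kernel
pair to an involution of `f₁^* X`, so `u` is cartesian because `f₁^* X ⟶ X` is.
-/

namespace ClovenBifibration

noncomputable section

section Functors

variable {K L : Type*} [Category K] [Category L]

theorem functor_ext_of_faithful {D : Type*} [Category D] (U : K ⥤ L) [U.Faithful] {F G : D ⥤ K}
    (hobj : ∀ X, F.obj X = G.obj X) (hU : F ⋙ U = G ⋙ U) : F = G :=
  CategoryTheory.Functor.ext hobj fun X Y t => U.map_injective (by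
    simpa [eqToHom_map] using Functor.congr_hom hU t)

/-- The equivalence given by two functors that are strictly inverse to each other. -/
def equivalenceOfEq (F : K ⥤ L) (G : L ⥤ K) (h : F ⋙ G = 𝟭 K) (h' : G ⋙ F = 𝟭 L) : K ≌ L :=
  CategoryTheory.Equivalence.mk F G (eqToIso h.symm) (eqToIso h')

end Functors

variable {C : Type u₁} [Category.{v₁} C] {E : Type u₂} [Category.{v₂} E] {p : E ⥤ C}

section FiberArrows

variable {A B : C}

instance : (fiberInclusion : p.Fiber A ⥤ E).ReflectsIsomorphisms where
  reflects {X Y} t ht :=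
    ⟨(homOf (inv (I := ht) (fiberInclusion.map t)) : Y ⟶ X),
      Functor.Fiber.hom_ext (IsIso.hom_inv_id (I := ht) _),
      Functor.Fiber.hom_ext (IsIso.inv_hom_id (I := ht) _)⟩

theorem isIso_of_map_comp_isStronglyCartesian {c : B ⟶ A} {X Y : p.Fiber B} {Z : p.Fiber A}
    (t : X ⟶ Y) (u : fiberInclusion.obj Y ⟶ fiberInclusion.obj Z) [p.IsStronglyCartesian c u]
    [p.IsStronglyCartesian c (fiberInclusion.map t ≫ u)] : IsIso t := by
  have : p.IsStronglyCartesian (𝟙 B ≫ c) (fiberInclusion.map t ≫ u) := by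
    rwa [Category.id_comp]
  have := Functor.IsStronglyCartesian.of_comp p (f := 𝟙 B) (g := c) (φ := fiberInclusion.map t)
    (ψ := u)
  have := Functor.IsStronglyCartesian.isIso_of_base_isIso p (𝟙 B) (fiberInclusion.map t)
  exact isIso_of_reflects_iso t fiberInclusion

theorem isIso_of_comp_map_isStronglyCocartesian {c : B ⟶ A} {X : p.Fiber B} {Y Z : p.Fiber A}
    (u : fiberInclusion.obj X ⟶ fiberInclusion.obj Y) (t : Y ⟶ Z) [p.IsStronglyCocartesian c u]
    [p.IsStronglyCocartesian c (u ≫ fiberInclusion.map t)] : IsIso t := by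
  have : p.IsStronglyCocartesian (c ≫ 𝟙 A) (u ≫ fiberInclusion.map t) := by
    rwa [Category.comp_id]
  have := Functor.IsStronglyCocartesian.of_comp p (f := c) (g := 𝟙 A) (φ := u)
    (ψ := fiberInclusion.map t)
  have := Functor.IsStronglyCocartesian.isIso_of_base_isIso p (𝟙 A) (fiberInclusion.map t)
  exact isIso_of_reflects_iso t fiberInclusion

theorem isStronglyCocartesian_comp_map (c : B ⟶ A) {X : p.Fiber B} {Y Z : p.Fiber A}
    (u : fiberInclusion.obj X ⟶ fiberInclusion.obj Y) [p.IsStronglyCocartesian c u] (t : Y ⟶ Z)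
    [IsIso t] : p.IsStronglyCocartesian c (u ≫ fiberInclusion.map t) := by
  have : p.IsStronglyCocartesian (c ≫ 𝟙 A) (u ≫ fiberInclusion.map t) := inferInstance
  rwa [Category.comp_id] at this

/-- The arrows of `E` over `c` between two objects of fibers. -/
abbrev HomOver (c : B ⟶ A) (X : p.Fiber B) (Y : p.Fiber A) :=
  {u : fiberInclusion.obj X ⟶ fiberInclusion.obj Y // p.IsHomLift c u}

instance (c : B ⟶ A) (X : p.Fiber B) (Y : p.Fiber A) (u : HomOver c X Y) :
    p.IsHomLift c u.1 := u.2

/-- Arrows of a fiber into the domain of a cartesian arrow over `c` are the arrows over `c` into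
its codomain. -/
def cartHomEquiv (c : B ⟶ A) {X Y : p.Fiber B} {Z : p.Fiber A}
    (u : fiberInclusion.obj Y ⟶ fiberInclusion.obj Z) [p.IsCartesian c u] :
    (X ⟶ Y) ≃ HomOver c X Z where
  toFun t := ⟨fiberInclusion.map t ≫ u, inferInstance⟩
  invFun v := homOf (Functor.IsCartesian.map p c u v.1)
  left_inv t := Functor.Fiber.hom_ext
    (Functor.IsCartesian.map_uniq p c u _ (fiberInclusion.map t) rfl).symm
  right_inv v := Subtype.ext (Functor.IsCartesian.fac p c u v.1)

/-- Arrows of a fiber out of the codomain of a cocartesian arrow over `c` are the arrows over `c`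
out of its domain. -/
def cocartHomEquiv (c : B ⟶ A) {X : p.Fiber B} {Y Z : p.Fiber A}
    (u : fiberInclusion.obj X ⟶ fiberInclusion.obj Y) [p.IsCocartesian c u] :
    (Y ⟶ Z) ≃ HomOver c X Z where
  toFun t := ⟨u ≫ fiberInclusion.map t, inferInstance⟩
  invFun v := homOf (Functor.IsCocartesian.map p c u v.1)
  left_inv t := Functor.Fiber.hom_ext
    (Functor.IsCocartesian.map_uniq p c u _ (fiberInclusion.map t) rfl).symm
  right_inv v := Subtype.ext (Functor.IsCocartesian.fac p c u v.1)

theorem map_comp_inj (c : B ⟶ A) {X Y : p.Fiber B} {Z : p.Fiber A}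
    (u : fiberInclusion.obj Y ⟶ fiberInclusion.obj Z) [p.IsCartesian c u] {s t : X ⟶ Y} :
    fiberInclusion.map s ≫ u = fiberInclusion.map t ≫ u ↔ s = t :=
  Subtype.ext_iff.symm.trans (cartHomEquiv c u).injective.eq_iff

theorem comp_map_inj (c : B ⟶ A) {X : p.Fiber B} {Y Z : p.Fiber A}
    (u : fiberInclusion.obj X ⟶ fiberInclusion.obj Y) [p.IsCocartesian c u] {s t : Y ⟶ Z} :
    u ≫ fiberInclusion.map s = u ≫ fiberInclusion.map t ↔ s = t :=
  Subtype.ext_iff.symm.trans (cocartHomEquiv c u).injective.eq_iff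

end FiberArrows

variable (b : ClovenBifibration p)

section CartLift

variable {A B D : C} {f : B ⟶ A} {g : D ⟶ B} {r : D ⟶ A} {X : p.Fiber A} {Z : E}

/-- The factorization over `g` of an arrow over `g ≫ f` through the cartesian lift of `f`. The
composite is allowed to be given as any `r` with a proof of `g ≫ f = r`. -/
def cartLift (w : g ≫ f = r) (t : Z ⟶ fiberInclusion.obj X) [p.IsHomLift r t] :
    Z ⟶ fiberInclusion.obj (b.pullObj f X) :=
  Functor.IsStronglyCartesian.map p f (b.cart f X) w.symm t

instance (w : g ≫ f = r) (t : Z ⟶ fiberInclusion.obj X) [p.IsHomLift r t] :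
    p.IsHomLift g (b.cartLift w t) :=
  Functor.IsStronglyCartesian.map_isHomLift p f (b.cart f X) w.symm t

theorem cartLift_fac (w : g ≫ f = r) (t : Z ⟶ fiberInclusion.obj X) [p.IsHomLift r t] :
    b.cartLift w t ≫ b.cart f X = t :=
  Functor.IsStronglyCartesian.fac p f (b.cart f X) w.symm t

theorem cart_ext {g' : D ⟶ B} (hg : g = g') {s t : Z ⟶ fiberInclusion.obj (b.pullObj f X)}
    [p.IsHomLift g s] [p.IsHomLift g' t] (h : s ≫ b.cart f X = t ≫ b.cart f X) : s = t := by
  subst hg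
  exact Functor.IsStronglyCartesian.ext p f (b.cart f X) g h

end CartLift

theorem kappaApp_inv_fac {A B D : C} (f : B ⟶ A) (g : D ⟶ B) (h : D ⟶ A) (w : g ≫ f = h)
    (Y : p.Fiber A) :
    fiberInclusion.map (b.kappaApp f g h w Y).inv ≫ b.cart g (b.pullObj f Y) ≫ b.cart f Y =
      b.cart h Y := by
  rw [← kappaApp_fac b f g h w, ← Functor.map_comp_assoc, Iso.inv_hom_id,
    CategoryTheory.Functor.map_id, Category.id_comp]

section BaseChange

variable {P B Q D : C} {a : P ⟶ B} {c : P ⟶ Q} {d : B ⟶ D} {e : Q ⟶ D}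

/-- The arrow `a^* X ⟶ e^* Y` over `c` induced by an arrow `X ⟶ Y` over `d` along a commutative
square `d ∘ a = e ∘ c`. -/
def baseChange (w : a ≫ d = c ≫ e) {X : p.Fiber B} {Y : p.Fiber D}
    (u : fiberInclusion.obj X ⟶ fiberInclusion.obj Y) [p.IsHomLift d u] :
    fiberInclusion.obj (b.pullObj a X) ⟶ fiberInclusion.obj (b.pullObj e Y) :=
  b.cartLift w.symm (b.cart a X ≫ u)

variable (w : a ≫ d = c ≫ e) {X X' : p.Fiber B} {Y Y' : p.Fiber D}

instance (u : fiberInclusion.obj X ⟶ fiberInclusion.obj Y) [p.IsHomLift d u] :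
    p.IsHomLift c (b.baseChange w u) := by
  unfold baseChange; infer_instance

theorem baseChange_fac (u : fiberInclusion.obj X ⟶ fiberInclusion.obj Y) [p.IsHomLift d u] :
    b.baseChange w u ≫ b.cart e Y = b.cart a X ≫ u :=
  b.cartLift_fac _ _

theorem eq_baseChange (u : fiberInclusion.obj X ⟶ fiberInclusion.obj Y) [p.IsHomLift d u]
    {v : fiberInclusion.obj (b.pullObj a X) ⟶ fiberInclusion.obj (b.pullObj e Y)}
    [p.IsHomLift c v] (h : v ≫ b.cart e Y = b.cart a X ≫ u) : v = b.baseChange w u :=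
  b.cart_ext (g := c) rfl (h.trans (b.baseChange_fac w u).symm)

theorem map_comp_baseChange (t : X ⟶ X') (u : fiberInclusion.obj X' ⟶ fiberInclusion.obj Y)
    [p.IsHomLift d u] :
    fiberInclusion.map (b.pullMap a t) ≫ b.baseChange w u =
      b.baseChange w (fiberInclusion.map t ≫ u) :=
  b.eq_baseChange w _ (by rw [Category.assoc, baseChange_fac, reassoc_of% b.pullMap_fac])

theorem baseChange_comp_map (u : fiberInclusion.obj X ⟶ fiberInclusion.obj Y) [p.IsHomLift d u]
    (t : Y ⟶ Y') :
    b.baseChange w u ≫ fiberInclusion.map (b.pullMap e t) =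
      b.baseChange w (u ≫ fiberInclusion.map t) :=
  b.eq_baseChange w _ (by rw [Category.assoc, pullMap_fac, reassoc_of% b.baseChange_fac w])

/-- The component of `chi` at `Y`, with source and target spelled with `pullObj` so that the
factorization lemmas for `cart` rewrite it. The other components below are spelled likewise. -/
def chiApp (Y : p.Fiber D) : b.pullObj a (b.pullObj d Y) ≅ b.pullObj c (b.pullObj e Y) :=
  b.kappaApp d a (c ≫ e) w Y ≪≫ (b.kappaApp e c (c ≫ e) rfl Y).symm

theorem map_chiApp_hom_comp_cart (Y : p.Fiber D) :
    fiberInclusion.map (b.chiApp w Y).hom ≫ b.cart c (b.pullObj e Y) =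
      b.baseChange w (b.cart d Y) :=
  b.eq_baseChange w _ (by
    rw [chiApp, Iso.trans_hom, Functor.map_comp, Category.assoc, Category.assoc, Iso.symm_hom,
      kappaApp_inv_fac, kappaApp_fac])

theorem map_chiApp_inv_comp_cart (Y : p.Fiber D) :
    fiberInclusion.map (b.chiApp w Y).inv ≫ b.cart a (b.pullObj d Y) =
      b.baseChange w.symm (b.cart e Y) :=
  b.eq_baseChange w.symm _ (by
    rw [chiApp, Iso.trans_inv, Functor.map_comp, Category.assoc, Category.assoc, Iso.symm_inv,
      kappaApp_inv_fac, kappaApp_fac])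

/-- The component of the Beck-Chevalley transformation at `X`. -/
def beckChevalleyApp (X : p.Fiber B) :
    b.pushObj c (b.pullObj a X) ⟶ b.pullObj e (b.pushObj d X) :=
  (b.beckChevalley w).app X

theorem cocart_comp_map_beckChevalleyApp (X : p.Fiber B) :
    b.cocart c (b.pullObj a X) ≫ fiberInclusion.map (b.beckChevalleyApp w X) =
      b.baseChange w (b.cocart d X) := by
  change b.cocart c _ ≫ fiberInclusion.map (b.pushMap c (b.pullMap a (b.unitApp d X)) ≫
    b.pushMap c (b.chiApp w (b.pushObj d X)).hom ≫ b.counitApp c _) = _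
  rw [Functor.map_comp, Functor.map_comp, reassoc_of% b.pushMap_fac, reassoc_of% b.pushMap_fac,
    counitApp_fac, map_chiApp_hom_comp_cart, map_comp_baseChange]
  simp only [unitApp_fac]

variable {b}

theorem BeckChevalley.isStronglyCocartesian_baseChange (h : b.BeckChevalley)
    (sq : IsPullback a c d e) (u : fiberInclusion.obj X ⟶ fiberInclusion.obj Y)
    [p.IsStronglyCocartesian d u] : p.IsStronglyCocartesian c (b.baseChange sq.w u) := by
  have : IsIso (b.beckChevalleyApp sq.w X) :=
    haveI := h sq
    inferInstanceAs (IsIso ((b.beckChevalley sq.w).app X))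
  have : p.IsStronglyCocartesian d
      (b.cocart d X ≫ fiberInclusion.map (b.pushDesc d u)) := by
    rwa [pushDesc_fac]
  have : IsIso (b.pushDesc d u) :=
    isIso_of_comp_map_isStronglyCocartesian (c := d) (b.cocart d X) _
  have : IsIso (b.pullMap e (b.pushDesc d u)) :=
    inferInstanceAs (IsIso ((b.pull e).map (b.pushDesc d u)))
  have fac : b.baseChange sq.w u = b.cocart c (b.pullObj a X) ≫
      fiberInclusion.map (b.beckChevalleyApp sq.w X ≫ b.pullMap e (b.pushDesc d u)) := by
    rw [Functor.map_comp, reassoc_of% b.cocart_comp_map_beckChevalleyApp, baseChange_comp_map]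
    simp only [pushDesc_fac]
  rw [fac]
  exact isStronglyCocartesian_comp_map c _ _

end BaseChange

section KernelPair

variable [HasPullbacks C] {A B : C} (f : B ⟶ A)

/-- The symmetry of the kernel pair of `f`. -/
def swap : ker f ⟶ ker f :=
  pullback.lift (f₂ f) (f₁ f) pullback.condition.symm

theorem swap_f₁ : swap f ≫ f₁ f = f₂ f := pullback.lift_fst _ _ _

theorem swap_f₂ : swap f ≫ f₂ f = f₁ f := pullback.lift_snd _ _ _

theorem swap_swap : swap f ≫ swap f = 𝟙 (ker f) := by
  apply pullback.hom_ext
  · rw [Category.assoc, swap_f₁, swap_f₂, Category.id_comp]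
  · rw [Category.assoc, swap_f₂, swap_f₁, Category.id_comp]

/-- The composable pair `((x, y), (y, x))` of an element `(x, y)` of the kernel pair of `f`. -/
def withInverse : ker f ⟶ ker₂ f :=
  pullback.lift (𝟙 (ker f)) (swap f) (by rw [swap_f₁, Category.id_comp])

theorem withInverse_π₂ : withInverse f ≫ π₂ f = 𝟙 (ker f) := pullback.lift_fst _ _ _

theorem withInverse_π₁ : withInverse f ≫ π₁ f = swap f := pullback.lift_snd _ _ _

theorem withInverse_π : withInverse f ≫ π f = f₁ f ≫ diag f := by
  apply pullback.hom_ext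
  · rw [Category.assoc, Category.assoc, π_f₁, diag_f₁, reassoc_of% withInverse_π₂ f,
      Category.comp_id]
  · rw [Category.assoc, Category.assoc, π_f₂, diag_f₂, reassoc_of% withInverse_π₁ f, swap_f₂,
      Category.comp_id]

end KernelPair

section Action

variable [HasPullbacks C] {A B : C} (f : B ⟶ A)

/-- The section `X ⟶ f₁^* X` over the diagonal of the cartesian lift of `f₁`: the identities of the
internal category `Eq(f)` acting on the free action. -/
def diagLift (X : p.Fiber B) : fiberInclusion.obj X ⟶ fiberInclusion.obj (b.pullObj (f₁ f) X) :=
  haveI := id_isHomLift X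
  b.cartLift (diag_f₁ f) (𝟙 (fiberInclusion.obj X))

instance (X : p.Fiber B) : p.IsHomLift (diag f) (b.diagLift f X) := by
  unfold diagLift; infer_instance

theorem diagLift_fac (X : p.Fiber B) :
    b.diagLift f X ≫ b.cart (f₁ f) X = 𝟙 (fiberInclusion.obj X) :=
  haveI := id_isHomLift X
  b.cartLift_fac (diag_f₁ f) _

/-- The arrow `π₂^* f₁^* X ⟶ f₁^* X` over the composition `π` of the internal category `Eq(f)`. -/
abbrev compLift (X : p.Fiber B) :
    fiberInclusion.obj (b.pullObj (π₂ f) (b.pullObj (f₁ f) X)) ⟶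
      fiberInclusion.obj (b.pullObj (f₁ f) X) :=
  b.baseChange (π_f₁ f).symm (b.cart (f₁ f) X)

variable {f} {X : p.Fiber B}

/-- An arrow `f₁^* X ⟶ X` over `f₂` that is unital and associative for the internal category
`Eq(f)`. Descent data, actions and algebra structures on `X` all amount to such arrows. -/
structure IsAction (u : HomOver (f₂ f) (b.pullObj (f₁ f) X) X) : Prop where
  unit : b.diagLift f X ≫ u.1 = 𝟙 (fiberInclusion.obj X)
  assoc : b.baseChange (π₂_f₂ f) u.1 ≫ u.1 = b.compLift f X ≫ u.1

/-- Compatibility of an arrow `θ : X ⟶ Y` with arrows `f₁^* X ⟶ X` and `f₁^* Y ⟶ Y` over `f₂`. -/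
def IsEquivariant {Y : p.Fiber B} (u : HomOver (f₂ f) (b.pullObj (f₁ f) X) X)
    (v : HomOver (f₂ f) (b.pullObj (f₁ f) Y) Y) (θ : X ⟶ Y) : Prop :=
  u.1 ≫ fiberInclusion.map θ = fiberInclusion.map (b.pullMap (f₁ f) θ) ≫ v.1

variable {b}

/-- The lift of the symmetry of the kernel pair to `f₁^* X` determined by `u : f₁^* X ⟶ X`:
it sends `(x, y, t)` to `(y, x, u t)`. -/
def swapLift (u : HomOver (f₂ f) (b.pullObj (f₁ f) X) X) :
    fiberInclusion.obj (b.pullObj (f₁ f) X) ⟶ fiberInclusion.obj (b.pullObj (f₁ f) X) :=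
  b.cartLift (swap_f₁ f) u.1

instance (u : HomOver (f₂ f) (b.pullObj (f₁ f) X) X) : p.IsHomLift (swap f) (swapLift u) := by
  unfold swapLift; infer_instance

theorem swapLift_fac (u : HomOver (f₂ f) (b.pullObj (f₁ f) X) X) :
    swapLift u ≫ b.cart (f₁ f) X = u.1 :=
  b.cartLift_fac (swap_f₁ f) _

namespace IsAction

variable {u : HomOver (f₂ f) (b.pullObj (f₁ f) X) X}

theorem swapLift_comp (h : b.IsAction u) : swapLift u ≫ u.1 = b.cart (f₁ f) X := by
  have := id_isHomLift (b.pullObj (f₁ f) X)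
  let t := b.cartLift (withInverse_π₂ f) (𝟙 (fiberInclusion.obj (b.pullObj (f₁ f) X)))
  have ht : t ≫ b.cart (π₂ f) (b.pullObj (f₁ f) X) = 𝟙 _ := b.cartLift_fac _ _
  have swap_eq : swapLift u = t ≫ b.baseChange (π₂_f₂ f) u.1 :=
    b.cart_ext (withInverse_π₁ f).symm (by
      rw [swapLift_fac, Category.assoc, baseChange_fac, reassoc_of% ht])
  have comp_eq : t ≫ b.compLift f X = b.cart (f₁ f) X ≫ b.diagLift f X :=
    b.cart_ext (withInverse_π f) (by
      rw [Category.assoc, Category.assoc, baseChange_fac, reassoc_of% ht, diagLift_fac,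
        Category.comp_id])
  calc swapLift u ≫ u.1 = t ≫ b.compLift f X ≫ u.1 := by rw [swap_eq, Category.assoc, h.assoc]
    _ = b.cart (f₁ f) X := by rw [reassoc_of% comp_eq, h.unit, Category.comp_id]

theorem swapLift_swapLift (h : b.IsAction u) : swapLift u ≫ swapLift u = 𝟙 _ :=
  haveI := id_isHomLift (b.pullObj (f₁ f) X)
  b.cart_ext (swap_swap f) (by
    rw [Category.assoc, swapLift_fac, h.swapLift_comp, Category.id_comp])

theorem isStronglyCartesian (h : b.IsAction u) : p.IsStronglyCartesian (f₂ f) u.1 := by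
  have : IsIso (swapLift u) := ⟨swapLift u, h.swapLift_swapLift, h.swapLift_swapLift⟩
  rw [← swapLift_fac u, ← swap_f₁ f]
  infer_instance

end IsAction

theorem isAction_cocartHomEquiv_iff (h : b.BeckChevalley) {Y Z : p.Fiber B}
    {κ : fiberInclusion.obj (b.pullObj (f₁ f) X) ⟶ fiberInclusion.obj Y}
    [p.IsStronglyCocartesian (f₂ f) κ]
    (κ' : fiberInclusion.obj (b.pullObj (f₁ f) Y) ⟶ fiberInclusion.obj Z)
    [p.IsStronglyCocartesian (f₂ f) κ'] {α : Y ⟶ X} {η : X ⟶ Y} {μ Tα : Z ⟶ Y}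
    (hη : fiberInclusion.map η = b.diagLift f X ≫ κ)
    (hμ : b.baseChange (π₂_f₂ f) κ ≫ κ' ≫ fiberInclusion.map μ = b.compLift f X ≫ κ)
    (hα : κ' ≫ fiberInclusion.map Tα = fiberInclusion.map (b.pullMap (f₁ f) α) ≫ κ) :
    b.IsAction (cocartHomEquiv (f₂ f) κ α) ↔ η ≫ α = 𝟙 X ∧ μ ≫ α = Tα ≫ α := by
  have := h.isStronglyCocartesian_baseChange (IsPullback.of_hasPullback (f₂ f) (f₁ f)) κ
  have unit_iff : b.diagLift f X ≫ κ ≫ fiberInclusion.map α = 𝟙 _ ↔ η ≫ α = 𝟙 X := by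
    rw [← reassoc_of% hη, ← Functor.map_comp, ← CategoryTheory.Functor.map_id]
    exact ⟨fun e => Functor.Fiber.hom_ext e, congrArg _⟩
  have assoc_iff : b.baseChange (π₂_f₂ f) (κ ≫ fiberInclusion.map α) ≫
      κ ≫ fiberInclusion.map α = b.compLift f X ≫ κ ≫ fiberInclusion.map α ↔
        μ ≫ α = Tα ≫ α := by
    rw [← comp_map_inj (π₁ f ≫ f₂ f) (b.baseChange (π₂_f₂ f) κ ≫ κ'), Functor.map_comp,
      Functor.map_comp, Category.assoc, Category.assoc, reassoc_of% hμ, reassoc_of% hα,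
      reassoc_of% b.baseChange_comp_map, eq_comm]
  exact ⟨fun hu => ⟨unit_iff.1 hu.unit, assoc_iff.1 hu.assoc⟩,
    fun hu => ⟨unit_iff.2 hu.1, assoc_iff.2 hu.2⟩⟩

theorem isEquivariant_cocartHomEquiv_iff {X' Y Y' : p.Fiber B}
    {κ : fiberInclusion.obj (b.pullObj (f₁ f) X) ⟶ fiberInclusion.obj Y}
    [p.IsCocartesian (f₂ f) κ]
    {κ' : fiberInclusion.obj (b.pullObj (f₁ f) X') ⟶ fiberInclusion.obj Y'}
    [p.IsCocartesian (f₂ f) κ'] {α : Y ⟶ X} {α' : Y' ⟶ X'} {θ : X ⟶ X'} {Tθ : Y ⟶ Y'}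
    (hθ : κ ≫ fiberInclusion.map Tθ = fiberInclusion.map (b.pullMap (f₁ f) θ) ≫ κ') :
    b.IsEquivariant (cocartHomEquiv (f₂ f) κ α) (cocartHomEquiv (f₂ f) κ' α') θ ↔
      α ≫ θ = Tθ ≫ α' := by
  rw [← comp_map_inj (f₂ f) κ, Functor.map_comp, Functor.map_comp, reassoc_of% hθ,
    ← Category.assoc]
  rfl

end Action

section Descent

variable [HasPullbacks C] {A B : C} (f : B ⟶ A) (X : p.Fiber B)

/-- The component of `d₁` at `X`. -/
def d₁App : X ≅ b.pullObj (diag f) (b.pullObj (f₁ f) X) :=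
  b.iotaApp X ≪≫ (b.kappaApp (f₁ f) (diag f) (𝟙 B) (diag_f₁ f) X).symm

/-- The component of `d₂` at `X`. -/
def d₂App : X ≅ b.pullObj (diag f) (b.pullObj (f₂ f) X) :=
  b.iotaApp X ≪≫ (b.kappaApp (f₂ f) (diag f) (𝟙 B) (diag_f₂ f) X).symm

theorem map_d₁App_hom_comp_cart :
    fiberInclusion.map (b.d₁App f X).hom ≫ b.cart (diag f) (b.pullObj (f₁ f) X) =
      b.diagLift f X :=
  b.cart_ext (g := diag f) rfl (by
    rw [diagLift_fac, d₁App, Iso.trans_hom, Iso.symm_hom, Functor.map_comp, Category.assoc,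
      Category.assoc, kappaApp_inv_fac, iotaApp_fac])

theorem map_d₂App_inv :
    fiberInclusion.map (b.d₂App f X).inv =
      b.cart (diag f) (b.pullObj (f₂ f) X) ≫ b.cart (f₂ f) X :=
  b.kappaApp_fac (f₂ f) (diag f) (𝟙 B) (diag_f₂ f) X

/-- Arrows `f₁^* X ⟶ f₂^* X` as arrows `f₁^* X ⟶ X` over `f₂`. -/
abbrev descEquiv :
    (b.pullObj (f₁ f) X ⟶ b.pullObj (f₂ f) X) ≃ HomOver (f₂ f) (b.pullObj (f₁ f) X) X :=
  cartHomEquiv (f₂ f) (b.cart (f₂ f) X)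

variable {f X} (φ : b.pullObj (f₁ f) X ⟶ b.pullObj (f₂ f) X)

theorem dd1_iff :
    (b.d₁ f).hom.app X ≫ (b.pull (diag f)).map φ ≫ (b.d₂ f).inv.app X = 𝟙 X ↔
      b.diagLift f X ≫ fiberInclusion.map φ ≫ b.cart (f₂ f) X = 𝟙 (fiberInclusion.obj X) := by
  have fac : fiberInclusion.map ((b.d₁App f X).hom ≫ b.pullMap (diag f) φ ≫ (b.d₂App f X).inv) =
      b.diagLift f X ≫ fiberInclusion.map φ ≫ b.cart (f₂ f) X := by
    rw [Functor.map_comp, Functor.map_comp, map_d₂App_inv, reassoc_of% b.pullMap_fac,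
      reassoc_of% b.map_d₁App_hom_comp_cart]
  rw [← fac, ← CategoryTheory.Functor.map_id]
  exact ⟨congrArg _, fun e => Functor.Fiber.hom_ext e⟩

theorem dd2_iff :
    (b.pull (π₂ f)).map φ ≫ (b.j f).hom.app X ≫ (b.pull (π₁ f)).map φ =
        (b.j₁ f).inv.app X ≫ (b.pull (π f)).map φ ≫ (b.j₂ f).hom.app X ↔
      b.baseChange (π₂_f₂ f) (fiberInclusion.map φ ≫ b.cart (f₂ f) X) ≫
          fiberInclusion.map φ ≫ b.cart (f₂ f) X =
        b.compLift f X ≫ fiberInclusion.map φ ≫ b.cart (f₂ f) X := by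
  have := b.cartComp_isStronglyCartesian (f₂ f) (π₁ f) (π₁ f ≫ f₂ f) rfl X
  have fac_left : fiberInclusion.map (b.pullMap (π₂ f) φ ≫ (b.chiApp (π₂_f₂ f) X).hom ≫
      b.pullMap (π₁ f) φ) ≫ b.cartComp (f₂ f) (π₁ f) X =
        b.baseChange (π₂_f₂ f) (fiberInclusion.map φ ≫ b.cart (f₂ f) X) ≫
          fiberInclusion.map φ ≫ b.cart (f₂ f) X := by
    simp only [cartComp, Functor.map_comp, Category.assoc]
    rw [reassoc_of% b.pullMap_fac, reassoc_of% b.map_chiApp_hom_comp_cart,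
      reassoc_of% b.map_comp_baseChange]
  have fac_right : fiberInclusion.map ((b.chiApp (π_f₁ f) X).inv ≫ b.pullMap (π f) φ ≫
      (b.chiApp (π_f₂ f) X).hom) ≫ b.cartComp (f₂ f) (π₁ f) X =
        b.compLift f X ≫ fiberInclusion.map φ ≫ b.cart (f₂ f) X := by
    simp only [cartComp, Functor.map_comp, Category.assoc]
    rw [reassoc_of% b.map_chiApp_hom_comp_cart, baseChange_fac, reassoc_of% b.pullMap_fac,
      reassoc_of% b.map_chiApp_inv_comp_cart]
  rw [← fac_left, ← fac_right, map_comp_inj (π₁ f ≫ f₂ f)]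
  rfl

variable {b φ}

theorem isAction_descEquiv_iff :
    b.IsAction (b.descEquiv f X φ) ↔
      (b.d₁ f).hom.app X ≫ (b.pull (diag f)).map φ ≫ (b.d₂ f).inv.app X = 𝟙 X ∧
        (b.pull (π₂ f)).map φ ≫ (b.j f).hom.app X ≫ (b.pull (π₁ f)).map φ =
          (b.j₁ f).inv.app X ≫ (b.pull (π f)).map φ ≫ (b.j₂ f).hom.app X :=
  ⟨fun h => ⟨(b.dd1_iff φ).2 h.unit, (b.dd2_iff φ).2 h.assoc⟩,
    fun h => ⟨(b.dd1_iff φ).1 h.1, (b.dd2_iff φ).1 h.2⟩⟩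

theorem IsAction.isIso_of_descEquiv (h : b.IsAction (b.descEquiv f X φ)) : IsIso φ :=
  haveI : p.IsStronglyCartesian (f₂ f) (fiberInclusion.map φ ≫ b.cart (f₂ f) X) :=
    h.isStronglyCartesian
  isIso_of_map_comp_isStronglyCartesian (c := f₂ f) φ (b.cart (f₂ f) X)

theorem isEquivariant_descEquiv_iff {Y : p.Fiber B} {ψ : b.pullObj (f₁ f) Y ⟶ b.pullObj (f₂ f) Y}
    {θ : X ⟶ Y} :
    b.IsEquivariant (b.descEquiv f X φ) (b.descEquiv f Y ψ) θ ↔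
      φ ≫ (b.pull (f₂ f)).map θ = (b.pull (f₁ f)).map θ ≫ ψ := by
  change _ ↔ φ ≫ b.pullMap (f₂ f) θ = b.pullMap (f₁ f) θ ≫ ψ
  rw [← map_comp_inj (f₂ f) (b.cart (f₂ f) Y), Functor.map_comp, Functor.map_comp, Category.assoc,
    Category.assoc, pullMap_fac, ← Category.assoc]
  rfl

end Descent

section EqAction

variable [HasPullbacks C] {A B : C} (f : B ⟶ A) (X : p.Fiber B)

/-- The component of `η'` at `X`. -/
def etaApp : X ⟶ b.pushObj (f₂ f) (b.pullObj (f₁ f) X) :=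
  (b.d₁App f X).hom ≫ b.pullMap (diag f) (b.unitApp (f₂ f) (b.pullObj (f₁ f) X)) ≫
    (b.d₂App f (b.pushObj (f₂ f) (b.pullObj (f₁ f) X))).inv

theorem map_etaApp :
    fiberInclusion.map (b.etaApp f X) =
      b.diagLift f X ≫ b.cocart (f₂ f) (b.pullObj (f₁ f) X) := by
  rw [etaApp, Functor.map_comp, Functor.map_comp, map_d₂App_inv, reassoc_of% b.pullMap_fac,
    reassoc_of% b.map_d₁App_hom_comp_cart, unitApp_fac]

/-- The component of `k₂` at `Z`. -/
def k₂App (Z : p.Fiber (ker₂ f)) :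
    b.pushObj (f₂ f) (b.pushObj (π₁ f) Z) ⟶ b.pushObj (f₂ f) (b.pushObj (π f) Z) :=
  (b.k₂ f).app Z

theorem k₂App_fac (Z : p.Fiber (ker₂ f)) :
    b.cocart (π₁ f) Z ≫ b.cocart (f₂ f) (b.pushObj (π₁ f) Z) ≫
        fiberInclusion.map (b.k₂App f Z) =
      b.cocart (π f) Z ≫ b.cocart (f₂ f) (b.pushObj (π f) Z) := by
  let Y := b.pushObj (f₂ f) (b.pushObj (π f) Z)
  have mate := unit_conjugateEquiv_symm ((b.adj (π f)).comp (b.adj (f₂ f)))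
    ((b.adj (π₁ f)).comp (b.adj (f₂ f))) (b.j₂ f).hom Z
  rw [Adjunction.comp_unit_app, Adjunction.comp_unit_app] at mate
  replace mate : (b.unitApp (π f) Z ≫ b.pullMap (π f) (b.unitApp (f₂ f) (b.pushObj (π f) Z))) ≫
      (b.chiApp (π_f₂ f) Y).hom =
    (b.unitApp (π₁ f) Z ≫ b.pullMap (π₁ f) (b.unitApp (f₂ f) (b.pushObj (π₁ f) Z))) ≫
      b.pullMap (π₁ f) (b.pullMap (f₂ f) (b.k₂App f Z)) := mate
  have fac := congrArg
    (fun s => fiberInclusion.map s ≫ b.cart (π₁ f) (b.pullObj (f₂ f) Y) ≫ b.cart (f₂ f) Y) mate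
  simp only [Functor.map_comp, Category.assoc, reassoc_of% b.map_chiApp_hom_comp_cart,
    baseChange_fac, reassoc_of% b.pullMap_fac, unitApp_fac, reassoc_of% b.unitApp_fac,
    pullMap_fac, Y] at fac
  exact fac.symm

/-- Arrows `(f₂)_! f₁^* X ⟶ X` as arrows `f₁^* X ⟶ X` over `f₂`. -/
abbrev actEquiv :
    (b.pushObj (f₂ f) (b.pullObj (f₁ f) X) ⟶ X) ≃ HomOver (f₂ f) (b.pullObj (f₁ f) X) X :=
  cocartHomEquiv (f₂ f) (b.cocart (f₂ f) (b.pullObj (f₁ f) X))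

variable {b} (h : b.BeckChevalley)

/-- The component of the inverse Beck-Chevalley transformation at `Y`. -/
def bcInvApp (Y : p.Fiber (ker f)) :
    b.pullObj (f₁ f) (b.pushObj (f₂ f) Y) ⟶ b.pushObj (π₁ f) (b.pullObj (π₂ f) Y) :=
  (bcInv h f).app Y

theorem baseChange_comp_map_bcInvApp (Y : p.Fiber (ker f)) :
    b.baseChange (π₂_f₂ f) (b.cocart (f₂ f) Y) ≫ fiberInclusion.map (bcInvApp f h Y) =
      b.cocart (π₁ f) (b.pullObj (π₂ f) Y) := by
  have := h (IsPullback.of_hasPullback (f₂ f) (f₁ f))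
  have hom_inv_id : b.beckChevalleyApp (π₂_f₂ f) Y ≫ bcInvApp f h Y = 𝟙 _ :=
    NatTrans.congr_app (IsIso.hom_inv_id (b.beckChevalley (π₂_f₂ f))) Y
  rw [← cocart_comp_map_beckChevalleyApp, Category.assoc, ← Functor.map_comp, hom_inv_id,
    CategoryTheory.Functor.map_id, Category.comp_id]

/-- The component of `μ'` at `X`. -/
def muApp : b.pushObj (f₂ f) (b.pullObj (f₁ f) (b.pushObj (f₂ f) (b.pullObj (f₁ f) X))) ⟶
    b.pushObj (f₂ f) (b.pullObj (f₁ f) X) :=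
  b.pushMap (f₂ f) (bcInvApp f h (b.pullObj (f₁ f) X)) ≫
    b.pushMap (f₂ f) (b.pushMap (π₁ f) (b.chiApp (π_f₁ f) X).inv) ≫
    b.k₂App f (b.pullObj (π f) (b.pullObj (f₁ f) X)) ≫
    b.pushMap (f₂ f) (b.counitApp (π f) (b.pullObj (f₁ f) X))

theorem muApp_fac :
    b.baseChange (π₂_f₂ f) (b.cocart (f₂ f) (b.pullObj (f₁ f) X)) ≫
      b.cocart (f₂ f) (b.pullObj (f₁ f) (b.pushObj (f₂ f) (b.pullObj (f₁ f) X))) ≫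
        fiberInclusion.map (muApp f X h) =
      b.compLift f X ≫ b.cocart (f₂ f) (b.pullObj (f₁ f) X) := by
  rw [muApp, Functor.map_comp, Functor.map_comp, Functor.map_comp, reassoc_of% b.pushMap_fac,
    reassoc_of% b.pushMap_fac, reassoc_of% baseChange_comp_map_bcInvApp f h,
    reassoc_of% b.pushMap_fac, reassoc_of% b.k₂App_fac, pushMap_fac, reassoc_of% b.counitApp_fac,
    reassoc_of% b.map_chiApp_inv_comp_cart]

variable {f X} {β : b.pushObj (f₂ f) (b.pullObj (f₁ f) X) ⟶ X}

theorem isAction_actEquiv_iff :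
    b.IsAction (b.actEquiv f X β) ↔ b.eta' f X ≫ β = 𝟙 X ∧
      mu' h f X ≫ β = (b.push (f₂ f)).map ((b.pull (f₁ f)).map β) ≫ β :=
  isAction_cocartHomEquiv_iff h
    (b.cocart (f₂ f) (b.pullObj (f₁ f) (b.pushObj (f₂ f) (b.pullObj (f₁ f) X))))
    (b.map_etaApp f X) (muApp_fac f X h) (b.pushMap_fac (f₂ f) _)

theorem isEquivariant_actEquiv_iff {Y : p.Fiber B}
    {γ : b.pushObj (f₂ f) (b.pullObj (f₁ f) Y) ⟶ Y} {θ : X ⟶ Y} :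
    b.IsEquivariant (b.actEquiv f X β) (b.actEquiv f Y γ) θ ↔
      β ≫ θ = (b.push (f₂ f)).map ((b.pull (f₁ f)).map θ) ≫ γ :=
  isEquivariant_cocartHomEquiv_iff (b.pushMap_fac (f₂ f) _)

end EqAction

section Monad

variable [HasPullbacks C] {A B : C} (f : B ⟶ A) (X : p.Fiber B)

/-- The arrow `f₁^* X ⟶ f^* f_! X` over `f₂` corresponding to the Beck-Chevalley transformation of
the kernel pair of `f`. Under the Beck-Chevalley condition it is cocartesian and makes `f^* f_! X`
another choice of the direct image of `f₁^* X` along `f₂`. -/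
abbrev kerArrow : fiberInclusion.obj (b.pullObj (f₁ f) X) ⟶
    fiberInclusion.obj (b.pullObj f (b.pushObj f X)) :=
  b.baseChange pullback.condition (b.cocart f X)

theorem map_unitApp :
    fiberInclusion.map (b.unitApp f X) = b.diagLift f X ≫ b.kerArrow f X :=
  b.cart_ext (diag_f₂ f).symm (by
    rw [Category.assoc, baseChange_fac, unitApp_fac, ← Category.assoc, diagLift_fac,
      Category.id_comp])

theorem kerArrow_comp_map_pullMap_counitApp :
    b.baseChange (π₂_f₂ f) (b.kerArrow f X) ≫ b.kerArrow f (b.pullObj f (b.pushObj f X)) ≫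
        fiberInclusion.map (b.pullMap f (b.counitApp f (b.pushObj f X))) =
      b.compLift f X ≫ b.kerArrow f X :=
  b.cart_ext (π_f₂ f).symm (by
    simp only [Category.assoc]
    rw [pullMap_fac, reassoc_of% b.baseChange_fac, counitApp_fac, baseChange_fac,
      reassoc_of% b.baseChange_fac, baseChange_fac, reassoc_of% b.baseChange_fac])

variable {X} in
theorem kerArrow_comp_map_pullMap_pushMap {Y : p.Fiber B} (t : X ⟶ Y) :
    b.kerArrow f X ≫ fiberInclusion.map (b.pullMap f (b.pushMap f t)) =
      fiberInclusion.map (b.pullMap (f₁ f) t) ≫ b.kerArrow f Y := by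
  rw [baseChange_comp_map, map_comp_baseChange]
  simp only [pushMap_fac]

variable {b} (h : b.BeckChevalley)

include h in
theorem isStronglyCocartesian_kerArrow : p.IsStronglyCocartesian (f₂ f) (b.kerArrow f X) :=
  h.isStronglyCocartesian_baseChange (IsPullback.of_hasPullback f f) (b.cocart f X)

/-- Arrows `f^* f_! X ⟶ X` as arrows `f₁^* X ⟶ X` over `f₂`. -/
abbrev algEquiv :
    (b.pullObj f (b.pushObj f X) ⟶ X) ≃ HomOver (f₂ f) (b.pullObj (f₁ f) X) X :=
  haveI := isStronglyCocartesian_kerArrow f X h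
  cocartHomEquiv (f₂ f) (b.kerArrow f X)

variable {f X} {α : b.pullObj f (b.pushObj f X) ⟶ X}

theorem isAction_algEquiv_iff :
    b.IsAction (algEquiv f X h α) ↔
      b.unitApp f X ≫ α = 𝟙 X ∧
        b.pullMap f (b.counitApp f (b.pushObj f X)) ≫ α = b.pullMap f (b.pushMap f α) ≫ α :=
  haveI := isStronglyCocartesian_kerArrow f X h
  haveI := isStronglyCocartesian_kerArrow f (b.pullObj f (b.pushObj f X)) h
  isAction_cocartHomEquiv_iff h (b.kerArrow f (b.pullObj f (b.pushObj f X))) (b.map_unitApp f X)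
    (b.kerArrow_comp_map_pullMap_counitApp f X) (b.kerArrow_comp_map_pullMap_pushMap f α)

theorem isEquivariant_algEquiv_iff {Y : p.Fiber B} {γ : b.pullObj f (b.pushObj f Y) ⟶ Y}
    {θ : X ⟶ Y} :
    b.IsEquivariant (algEquiv f X h α) (algEquiv f Y h γ) θ ↔
      α ≫ θ = b.pullMap f (b.pushMap f θ) ≫ γ :=
  haveI := isStronglyCocartesian_kerArrow f X h
  haveI := isStronglyCocartesian_kerArrow f Y h
  isEquivariant_cocartHomEquiv_iff (b.kerArrow_comp_map_pullMap_pushMap f θ)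

end Monad

section Functors

variable [HasPullbacks C] {A B : C} {f : B ⟶ A} {b} (h : b.BeckChevalley) {X : p.Fiber B}
  {u : HomOver (f₂ f) (b.pullObj (f₁ f) X) X}

/-- The arrow `f₁^* X ⟶ X` over `f₂` of a descent datum. -/
def Desc.arrow (M : b.Desc f) : HomOver (f₂ f) (b.pullObj (f₁ f) M.X) M.X :=
  b.descEquiv f M.X M.φ

theorem Desc.isAction_arrow (M : b.Desc f) : b.IsAction M.arrow :=
  isAction_descEquiv_iff.2 ⟨M.dd1, M.dd2⟩

/-- The descent datum of a unital and associative arrow `f₁^* X ⟶ X` over `f₂`. -/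
def Desc.ofIsAction (hu : b.IsAction u) : b.Desc f :=
  have hφ : b.IsAction (b.descEquiv f X ((b.descEquiv f X).symm u)) := by
    rwa [Equiv.apply_symm_apply]
  { X := X
    φ := (b.descEquiv f X).symm u
    isIso := hφ.isIso_of_descEquiv
    dd1 := (isAction_descEquiv_iff.1 hφ).1
    dd2 := (isAction_descEquiv_iff.1 hφ).2 }

theorem Desc.arrow_ofIsAction (hu : b.IsAction u) : (Desc.ofIsAction hu).arrow = u :=
  (b.descEquiv f X).apply_symm_apply u

theorem Desc.ofIsAction_eq {M : b.Desc f} {u : HomOver (f₂ f) (b.pullObj (f₁ f) M.X) M.X}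
    (hu : b.IsAction u) (e : u = M.arrow) : Desc.ofIsAction hu = M := by
  subst e
  obtain ⟨X, φ, -, -, -⟩ := M
  simp only [ofIsAction, arrow]
  congr 1
  exact (b.descEquiv f X).symm_apply_apply φ

theorem Desc.comm_iff {M N : b.Desc f} {θ : M.X ⟶ N.X} :
    b.IsEquivariant M.arrow N.arrow θ ↔
      M.φ ≫ (b.pull (f₂ f)).map θ = (b.pull (f₁ f)).map θ ≫ N.φ :=
  isEquivariant_descEquiv_iff

variable {h}

/-- The arrow `f₁^* X ⟶ X` over `f₂` of an action. -/
def Act.arrow (M : Act h f) : HomOver (f₂ f) (b.pullObj (f₁ f) M.X) M.X :=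
  b.actEquiv f M.X M.β

theorem Act.isAction_arrow (M : Act h f) : b.IsAction M.arrow :=
  (isAction_actEquiv_iff h).2 ⟨M.ac1, M.ac2⟩

variable (h) in
/-- The action of a unital and associative arrow `f₁^* X ⟶ X` over `f₂`. -/
def Act.ofIsAction (hu : b.IsAction u) : Act h f :=
  have hβ : b.IsAction (b.actEquiv f X ((b.actEquiv f X).symm u)) := by
    rwa [Equiv.apply_symm_apply]
  { X := X
    β := (b.actEquiv f X).symm u
    ac1 := ((isAction_actEquiv_iff h).1 hβ).1
    ac2 := ((isAction_actEquiv_iff h).1 hβ).2 }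

theorem Act.arrow_ofIsAction (hu : b.IsAction u) : (Act.ofIsAction h hu).arrow = u :=
  (b.actEquiv f X).apply_symm_apply u

theorem Act.ofIsAction_eq {M : Act h f} {u : HomOver (f₂ f) (b.pullObj (f₁ f) M.X) M.X}
    (hu : b.IsAction u) (e : u = M.arrow) : Act.ofIsAction h hu = M := by
  subst e
  obtain ⟨X, β, -, -⟩ := M
  simp only [ofIsAction, arrow]
  congr 1
  exact (b.actEquiv f X).symm_apply_apply β

theorem Act.comm_iff {M N : Act h f} {θ : M.X ⟶ N.X} :
    b.IsEquivariant M.arrow N.arrow θ ↔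
      M.β ≫ θ = (b.push (f₂ f)).map ((b.pull (f₁ f)).map θ) ≫ N.β :=
  isEquivariant_actEquiv_iff

variable (h)

/-- The arrow `f₁^* X ⟶ X` over `f₂` of an algebra. -/
def EM.arrow (M : b.EM f) : HomOver (f₂ f) (b.pullObj (f₁ f) M.A) M.A :=
  algEquiv f M.A h M.a

theorem EM.isAction_arrow (M : b.EM f) : b.IsAction (EM.arrow h M) :=
  (isAction_algEquiv_iff h).2 ⟨M.unit, M.assoc⟩

/-- The algebra of a unital and associative arrow `f₁^* X ⟶ X` over `f₂`. -/
def EM.ofIsAction (hu : b.IsAction u) : b.EM f :=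
  have hα : b.IsAction (algEquiv f X h ((algEquiv f X h).symm u)) := by
    rwa [Equiv.apply_symm_apply]
  { A := X
    a := (algEquiv f X h).symm u
    unit := ((isAction_algEquiv_iff h).1 hα).1
    assoc := ((isAction_algEquiv_iff h).1 hα).2 }

theorem EM.arrow_ofIsAction (hu : b.IsAction u) : EM.arrow h (EM.ofIsAction h hu) = u :=
  (algEquiv f X h).apply_symm_apply u

theorem EM.ofIsAction_eq {M : b.EM f} {u : HomOver (f₂ f) (b.pullObj (f₁ f) M.A) M.A}
    (hu : b.IsAction u) (e : u = EM.arrow h M) : EM.ofIsAction h hu = M := by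
  subst e
  obtain ⟨X, α, -, -⟩ := M
  simp only [ofIsAction, arrow]
  congr 1
  exact (algEquiv f X h).symm_apply_apply α

theorem EM.comm_iff {M N : b.EM f} {θ : M.A ⟶ N.A} :
    b.IsEquivariant (EM.arrow h M) (EM.arrow h N) θ ↔ (b.T f).map θ ≫ N.a = M.a ≫ θ :=
  (isEquivariant_algEquiv_iff h).trans eq_comm

variable (f)

/-- The functor `F : EM_p(T_f) ⥤ Desc_p(f)`. -/
def emToDesc : b.EM f ⥤ b.Desc f where
  obj M := Desc.ofIsAction (EM.isAction_arrow h M)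
  map {M N} s :=
    { θ := s.f
      comm := (Desc.comm_iff (M := Desc.ofIsAction (EM.isAction_arrow h M))
        (N := Desc.ofIsAction (EM.isAction_arrow h N))).1 (by
          rw [Desc.arrow_ofIsAction, Desc.arrow_ofIsAction]
          exact (EM.comm_iff h).2 s.h) }
  map_id _ := rfl
  map_comp _ _ := rfl

/-- The functor `G : Desc_p(f) ⥤ Act_p^{Eq(f)}`. -/
def descToAct : b.Desc f ⥤ Act h f where
  obj M := Act.ofIsAction h M.isAction_arrow
  map {M N} s :=
    { θ := s.θ
      comm := (Act.comm_iff (M := Act.ofIsAction h M.isAction_arrow)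
        (N := Act.ofIsAction h N.isAction_arrow)).1 (by
          rw [Act.arrow_ofIsAction, Act.arrow_ofIsAction]
          exact Desc.comm_iff.2 s.comm) }
  map_id _ := rfl
  map_comp _ _ := rfl

/-- The functor `H : Act_p^{Eq(f)} ⥤ EM_p(T_f)`. -/
def actToEM : Act h f ⥤ b.EM f where
  obj M := EM.ofIsAction h M.isAction_arrow
  map {M N} s :=
    { f := s.θ
      h := (EM.comm_iff h (M := EM.ofIsAction h M.isAction_arrow)
        (N := EM.ofIsAction h N.isAction_arrow)).1 (by
          rw [EM.arrow_ofIsAction, EM.arrow_ofIsAction]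
          exact Act.comm_iff.2 s.comm) }
  map_id _ := rfl
  map_comp _ _ := rfl

instance : (Desc.forget b f).Faithful where
  map_injective e := Desc.Hom.ext e

instance : (Act.forget f h).Faithful where
  map_injective e := Act.Hom.ext e

theorem emToDesc_descToAct_actToEM :
    emToDesc f h ⋙ descToAct f h ⋙ actToEM f h = 𝟭 (b.EM f) :=
  functor_ext_of_faithful (b.T f).forget (fun M =>
    EM.ofIsAction_eq (M := M) h (((emToDesc f h ⋙ descToAct f h).obj M).isAction_arrow)
      ((Act.arrow_ofIsAction ((emToDesc f h).obj M).isAction_arrow).trans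
        (Desc.arrow_ofIsAction (EM.isAction_arrow h M)))) rfl

theorem descToAct_actToEM_emToDesc :
    descToAct f h ⋙ actToEM f h ⋙ emToDesc f h = 𝟭 (b.Desc f) :=
  functor_ext_of_faithful (Desc.forget b f) (fun M =>
    Desc.ofIsAction_eq (M := M) (EM.isAction_arrow h ((descToAct f h ⋙ actToEM f h).obj M))
      ((EM.arrow_ofIsAction h ((descToAct f h).obj M).isAction_arrow).trans
        (Act.arrow_ofIsAction M.isAction_arrow))) rfl

theorem actToEM_emToDesc_descToAct :
    actToEM f h ⋙ emToDesc f h ⋙ descToAct f h = 𝟭 (Act h f) :=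
  functor_ext_of_faithful (Act.forget f h) (fun M =>
    Act.ofIsAction_eq (M := M) (((actToEM f h ⋙ emToDesc f h).obj M).isAction_arrow)
      ((Desc.arrow_ofIsAction (EM.isAction_arrow h ((actToEM f h).obj M))).trans
        (EM.arrow_ofIsAction h M.isAction_arrow))) rfl

end Functors

end

end ClovenBifibration

theorem theorem2 {C : Type u₁} [Category.{v₁} C] [HasPullbacks C] {E : Type u₂} [Category.{v₂} E]
    {p : E ⥤ C} (b : ClovenBifibration p) (h : b.BeckChevalley) {A B : C} (f : B ⟶ A) :
    ∃ (F : b.EM f ≌ b.Desc f) (G : b.Desc f ≌ ClovenBifibration.Act h f)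
      (H : ClovenBifibration.Act h f ≌ b.EM f),
      (F.functor ⋙ G.functor ⋙ H.functor = 𝟭 (b.EM f) ∧
        G.functor ⋙ H.functor ⋙ F.functor = 𝟭 (b.Desc f) ∧
        H.functor ⋙ F.functor ⋙ G.functor = 𝟭 (ClovenBifibration.Act h f)) ∧
      (F.functor ⋙ ClovenBifibration.Desc.forget b f = (b.T f).forget ∧
        G.functor ⋙ ClovenBifibration.Act.forget f h = ClovenBifibration.Desc.forget b f ∧
        H.functor ⋙ (b.T f).forget = ClovenBifibration.Act.forget f h) := by
  have hgf := ClovenBifibration.emToDesc_descToAct_actToEM f h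
  have fhg := ClovenBifibration.descToAct_actToEM_emToDesc f h
  have gfh := ClovenBifibration.actToEM_emToDesc_descToAct f h
  exact ⟨ClovenBifibration.equivalenceOfEq _ _ hgf fhg,
    ClovenBifibration.equivalenceOfEq _ _ fhg gfh, ClovenBifibration.equivalenceOfEq _ _ gfh hgf,
    ⟨hgf, fhg, gfh⟩, rfl, rfl, rfl⟩
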